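/- Let $p>2$ be a prime and let $v_p$ be the $p$-adic valuation on $\mathbb{Q}_p$. For $\alpha\in\mathbb{Q}_p$ let $s(\alpha)$ be the unique element of $\mathbb{Z}[1/p]\cap[0,p)$ with $|\alpha-s(\alpha)|_p<1$. The Ruban continued fraction expansion of $\alpha$ is the sequence $[a_0,a_1,\ldots]$ of partial quotients given by $\alpha_0=\alpha$, $a_n=s(\alpha_n)$ and $\alpha_{n+1}=1/(\alpha_n-a_n)$, where the algorithm stops if $\alpha_n=a_n$. The expansion is called periodic if it is infinite and the sequence $(a_n)$ is periodic from some index on. 1. There are infinitely many $\alpha\in\mathbb{Q}_p$, quadratic over $\mathbb{Q}$, with trace $\mathrm{Tr}_{\mathbb{Q}(\alpha)/\mathbb{Q}}(\alpha)=0$ and $v_p(\alpha)<0$, whose Ruban continued fraction expansion is periodic. For example, for every integer $h\ge 1$ there is a unique $\delta\in\mathbb{Q}_p$ with $\delta^2=1+p^{2h}$ and $\delta\equiv 1 \pmod p$; the number $\delta/p^h$ is quadratic over $\mathbb{Q}$, has trace $0$ and negative valuation, and its Ruban expansion is the periodic expansion $\left[\frac{1}{p^h},\overline{\frac{2}{p^h}}\right]$.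 2. Let $k>0$ be an integer and let $m$ be an integer that is not divisible by $p$, is not a perfect square, and has a square root in $\mathbb{Q}_p$. Then for either square root $\sqrt m\in\mathbb{Q}_p$ of $m$, the Ruban expansion of $p^k\sqrt m$ is not periodic. -/

import Mathlib

namespace RubanCF

/-- The set `ℤ[1/p] ∩ [0, p)` in which the partial quotients of Ruban continued fractions lie. -/
def digitSet (p : ℕ) : Set ℚ :=
  {a | (∃ (c : ℤ) (n : ℕ), a = (c : ℚ) / (p : ℚ) ^ n) ∧ 0 ≤ a ∧ a < p}

/-- Every `α ∈ ℚ_p` is congruent modulo `p ℤ_p` to an element of `ℤ[1/p] ∩ [0, p)`. -/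
theorem exists_digit (p : ℕ) [hp : Fact p.Prime] (α : ℚ_[p]) :
    ∃ a : ℚ, a ∈ digitSet p ∧ ‖α - (a : ℚ_[p])‖ < 1 := by
  have hp0 : (0 : ℝ) < p := by exact_mod_cast hp.out.pos
  have hp1 : (1 : ℝ) < p := by exact_mod_cast hp.out.one_lt
  have hpQ : (0 : ℚ) < p := by exact_mod_cast hp.out.pos
  have hpp : (p : ℚ_[p]) ≠ 0 := by exact_mod_cast hp.out.ne_zero
  obtain ⟨n, hn⟩ := pow_unbounded_of_one_lt ‖α‖ hp1
  have hx : ‖(p : ℚ_[p]) ^ n * α‖ ≤ 1 := by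
    rw [norm_mul, norm_pow, Padic.norm_p, inv_pow, inv_mul_le_iff₀ (by positivity), mul_one]
    exact hn.le
  let x : ℤ_[p] := ⟨(p : ℚ_[p]) ^ n * α, hx⟩
  have h1 := x.appr_lt (n + 1)
  have h2 := (PadicInt.norm_le_pow_iff_mem_span_pow _ (n + 1)).2 (x.appr_spec (n + 1))
  refine ⟨(x.appr (n + 1) : ℚ) / (p : ℚ) ^ n, ⟨⟨x.appr (n + 1), n, by simp⟩, by positivity, ?_⟩, ?_⟩
  · rw [div_lt_iff₀ (by positivity), ← pow_succ']
    exact_mod_cast h1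
  · have e : α - (((x.appr (n + 1) : ℚ) / (p : ℚ) ^ n : ℚ) : ℚ_[p])
        = ((p : ℚ_[p]) ^ n)⁻¹ * ((x - (x.appr (n + 1) : ℤ_[p]) : ℤ_[p]) : ℚ_[p]) := by
      push_cast
      field_simp
      change _ = (p : ℚ_[p]) ^ n * α - _
      ring
    rw [e, norm_mul, norm_inv, norm_pow, Padic.norm_p, inv_pow, inv_inv,
      PadicInt.padic_norm_e_of_padicInt]
    calc (p : ℝ) ^ n * _ ≤ (p : ℝ) ^ n * (p : ℝ) ^ (-((n + 1 : ℕ) : ℤ)) := by gcongr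
      _ = (p : ℝ)⁻¹ := by
        rw [zpow_neg, zpow_natCast, pow_succ]; field_simp
      _ < 1 := inv_lt_one_of_one_lt₀ hp1

/-- Two elements of `ℤ[1/p] ∩ [0, p)` that are congruent modulo `p ℤ_p` are equal. -/
theorem digit_unique (p : ℕ) [hp : Fact p.Prime] (α : ℚ_[p]) (a b : ℚ)
    (ha : a ∈ digitSet p) (hb : b ∈ digitSet p)
    (haα : ‖α - (a : ℚ_[p])‖ < 1) (hbα : ‖α - (b : ℚ_[p])‖ < 1) : a = b := by
  have hp1 : (1 : ℝ) < p := by exact_mod_cast hp.out.one_lt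
  have hpQ : (0 : ℚ) < p := by exact_mod_cast hp.out.pos
  obtain ⟨⟨c, n, hc⟩, ha0, hap⟩ := ha
  obtain ⟨⟨d, m, hd⟩, hb0, hbp⟩ := hb
  have hab : ‖((a - b : ℚ) : ℚ_[p])‖ < 1 := by
    have e : ((a - b : ℚ) : ℚ_[p]) = (α - b) - (α - a) := by push_cast; ring
    have hna := Padic.nonarchimedean (α - (b : ℚ_[p])) (-(α - (a : ℚ_[p])))
    rw [norm_neg, ← sub_eq_add_neg] at hna
    rw [e]
    exact lt_of_le_of_lt hna (max_lt hbα haα)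
  set z : ℤ := c * p ^ m - d * p ^ n with hz
  have hzab : (z : ℚ) = (p : ℚ) ^ (n + m) * (a - b) := by
    rw [hz, hc, hd]; push_cast; rw [pow_add]; field_simp
  have hzn : ‖(z : ℚ_[p])‖ < (p : ℝ) ^ (-((n + m : ℕ) : ℤ)) := by
    have : (z : ℚ_[p]) = (p : ℚ_[p]) ^ (n + m) * ((a - b : ℚ) : ℚ_[p]) := by
      rw [← Rat.cast_intCast, hzab]; push_cast; ring
    rw [this, norm_mul, norm_pow, Padic.norm_p, inv_pow, zpow_neg, zpow_natCast]
    exact mul_lt_of_lt_one_right (by positivity) hab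
  have hdvd : ((p ^ (n + m + 1) : ℕ) : ℤ) ∣ z := by
    have hle : ‖(z : ℚ_[p])‖ ≤ (p : ℝ) ^ (-((n + m + 1 : ℕ) : ℤ)) := by
      rw [Padic.norm_le_pow_iff_norm_lt_pow_add_one]
      convert hzn using 2
      push_cast; ring
    exact_mod_cast (Padic.norm_int_le_pow_iff_dvd z (n + m + 1)).1 hle
  obtain ⟨w, hw⟩ := hdvd
  have hpn : (0 : ℚ) < (p : ℚ) ^ (n + m) := by positivity
  have hw' : a - b = p * (w : ℚ) := by
    have h3 : (p : ℚ) ^ (n + m) * (a - b) = (p : ℚ) ^ (n + m) * (p * w) := by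
      rw [← hzab, hw]; push_cast; ring
    exact mul_left_cancel₀ hpn.ne' h3
  have hw1 : (w : ℚ) < 1 := by
    by_contra h
    nlinarith [not_lt.1 h]
  have hw2 : (-1 : ℚ) < w := by
    by_contra h
    nlinarith [not_lt.1 h]
  have hw0 : w = 0 := by
    have : w < 1 := by exact_mod_cast hw1
    have : -1 < w := by exact_mod_cast hw2
    omega
  rw [hw0] at hw'
  simpa [sub_eq_zero] using hw'

/-- The Ruban `s`-function: `s α` is the unique element of `ℤ[1/p] ∩ [0, p)` with
`|α - s α|_p < 1`. -/
noncomputable def s (p : ℕ) [Fact p.Prime] (α : ℚ_[p]) : ℚ :=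
  Classical.choose (exists_digit p α)

theorem s_eq_iff (p : ℕ) [Fact p.Prime] (α : ℚ_[p]) (a : ℚ) :
    s p α = a ↔ a ∈ digitSet p ∧ ‖α - (a : ℚ_[p])‖ < 1 := by
  have h := Classical.choose_spec (exists_digit p α)
  constructor
  · rintro rfl
    exact h
  · rintro ⟨h1, h2⟩
    exact digit_unique p α _ _ h.1 h1 h.2 h2

/-- The complete quotients `α_n` of the Ruban algorithm: `α_0 = α` and
`α_{n+1} = 1 / (α_n - s α_n)`. They have their meaning as long as the algorithm has not stopped,
that is, as long as `α_i ≠ s α_i` for all `i < n`. -/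
noncomputable def completeQuotient (p : ℕ) [Fact p.Prime] (α : ℚ_[p]) : ℕ → ℚ_[p]
  | 0 => α
  | n + 1 => 1 / (completeQuotient p α n - (s p (completeQuotient p α n) : ℚ_[p]))

/-- The partial quotients `a_n = s α_n` of the Ruban continued fraction of `α`. -/
noncomputable def partialQuotient (p : ℕ) [Fact p.Prime] (α : ℚ_[p]) (n : ℕ) : ℚ :=
  s p (completeQuotient p α n)

/-- The Ruban algorithm for `α` never stops: `α_n - a_n ≠ 0` for all `n`. -/
def IsInfinite (p : ℕ) [Fact p.Prime] (α : ℚ_[p]) : Prop :=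
  ∀ n, completeQuotient p α n - (partialQuotient p α n : ℚ_[p]) ≠ 0

/-- The Ruban continued fraction of `α` is (eventually) periodic: it is infinite, and its sequence
of partial quotients is periodic from some index on. -/
def IsPeriodic (p : ℕ) [Fact p.Prime] (α : ℚ_[p]) : Prop :=
  IsInfinite p α ∧
    ∃ N t : ℕ, 0 < t ∧ ∀ n, N ≤ n → partialQuotient p α (n + t) = partialQuotient p α n

/-- `α ∈ ℚ_p` is quadratic over `ℚ` and its trace, from `ℚ(α)` to `ℚ`, is zero. -/
def IsQuadraticOfTraceZero (p : ℕ) [Fact p.Prime] (α : ℚ_[p]) : Prop :=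
  Module.finrank ℚ (IntermediateField.adjoin ℚ {α}) = 2 ∧
    Algebra.trace ℚ (IntermediateField.adjoin ℚ {α}) (IntermediateField.AdjoinSimple.gen ℚ α) = 0

end RubanCF

namespace RubanCF

/-! Non-periodicity is decided at a real place. If the expansion of α = p^k√m is periodic, a
complete quotient in its tail is fixed by a Möbius map with positive rational coefficients
(`exists_moebius`). Its quadratic equation then has roots of negative product, so its norm is
negative, ℚ(√m) is real, and one real embedding makes this quotient positive
(`IsPeriodic.exists_conj_pos`). Since α_n = a_n + 1/α_{n+1} with a_n ≥ 0, positivity passes down to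
α_0 and α_2 (`IsInfinite.conj_pos`). Now a_0 = 0 and a_1 ≥ 1/p^k, so the image of α_1 = 1/α exceeds
1/p^k; yet it equals 1/(p^k s) with s² = m and s ≥ 1, a contradiction. The examples rest on (δ -
1)(δ + 1) = p^(2h): inverting the remainder (δ - 1)/p^h gives (δ + 1)/p^h, whose remainder is again
(δ - 1)/p^h. -/

open Polynomial in
theorem isQuadraticOfTraceZero_of_sq (p : ℕ) [Fact p.Prime] (z : ℚ_[p]) (q : ℚ)
    (hz : z ^ 2 = (q : ℚ_[p])) (hq : ∀ b : ℚ, b ^ 2 ≠ q) : IsQuadraticOfTraceZero p z := by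
  have hirr : Irreducible (X ^ 2 - C q : ℚ[X]) := X_pow_sub_C_irreducible_of_prime Nat.prime_two hq
  have hmonic : (X ^ 2 - C q : ℚ[X]).Monic := monic_X_pow_sub_C q two_ne_zero
  have hroot : aeval z (X ^ 2 - C q : ℚ[X]) = 0 := by simp [hz]
  have hint : IsIntegral ℚ z := ⟨_, hmonic, by simpa [aeval_def] using hroot⟩
  have hmin : minpoly ℚ z = X ^ 2 - C q :=
    (minpoly.eq_of_irreducible_of_monic hirr hroot hmonic).symm
  have hdeg : (minpoly ℚ z).natDegree = 2 := by rw [hmin, natDegree_X_pow_sub_C]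
  refine ⟨by rw [IntermediateField.adjoin.finrank hint, hdeg], ?_⟩
  have htr := (IntermediateField.adjoin.powerBasis hint).trace_gen_eq_nextCoeff_minpoly
  rw [IntermediateField.adjoin.powerBasis_gen] at htr
  rw [IntermediateField.minpoly_gen, nextCoeff_of_natDegree_pos (by omega), hdeg, hmin] at htr
  exact htr.trans (by simp)

/-! ### Convergence and positivity in the Ruban algorithm. -/

section Algorithm

variable {p : ℕ} [hp : Fact p.Prime] {α : ℚ_[p]}

theorem partialQuotient_mem (α : ℚ_[p]) (n : ℕ) : partialQuotient p α n ∈ digitSet p :=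
  ((s_eq_iff p (completeQuotient p α n) _).1 rfl).1

theorem norm_completeQuotient_sub_lt (α : ℚ_[p]) (n : ℕ) :
    ‖completeQuotient p α n - (partialQuotient p α n : ℚ_[p])‖ < 1 :=
  ((s_eq_iff p (completeQuotient p α n) _).1 rfl).2

theorem completeQuotient_succ (α : ℚ_[p]) (n : ℕ) : completeQuotient p α (n + 1) =
    1 / (completeQuotient p α n - (partialQuotient p α n : ℚ_[p])) := rfl

theorem completeQuotient_eq (α : ℚ_[p]) (n : ℕ) : completeQuotient p α n =
    partialQuotient p α n + 1 / completeQuotient p α (n + 1) := by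
  rw [completeQuotient_succ, one_div_one_div]; ring

theorem IsInfinite.completeQuotient_succ_ne_zero (h : IsInfinite p α) (n : ℕ) :
    completeQuotient p α (n + 1) ≠ 0 :=
  one_div_ne_zero (h n)

theorem IsInfinite.le_norm_completeQuotient_succ (h : IsInfinite p α) (n : ℕ) :
    (p : ℝ) ≤ ‖completeQuotient p α (n + 1)‖ := by
  have h1 : ‖completeQuotient p α n - (partialQuotient p α n : ℚ_[p])‖ ≤ (p : ℝ) ^ (-1 : ℤ) := by
    rw [Padic.norm_le_pow_iff_norm_lt_pow_add_one]
    simpa using norm_completeQuotient_sub_lt α n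
  have hp0 : (0 : ℝ) < p := by exact_mod_cast hp.out.pos
  rw [completeQuotient_succ, norm_div, norm_one, le_div_iff₀ (norm_pos_iff.2 (h n))]
  calc (p : ℝ) * _ ≤ p * (p : ℝ) ^ (-1 : ℤ) := by gcongr
    _ = 1 := by rw [zpow_neg_one, mul_inv_cancel₀ hp0.ne']

theorem IsInfinite.partialQuotient_succ_pos (h : IsInfinite p α) (n : ℕ) :
    0 < partialQuotient p α (n + 1) := by
  refine lt_of_le_of_ne (partialQuotient_mem α (n + 1)).2.1 fun h0 => ?_
  have h1 := norm_completeQuotient_sub_lt α (n + 1)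
  rw [← h0, Rat.cast_zero, sub_zero] at h1
  have h2 := h.le_norm_completeQuotient_succ n
  have hp1 : (1 : ℝ) < p := by exact_mod_cast hp.out.one_lt
  linarith

/-- Complete quotients followed by the same partial quotients are equal. -/
theorem IsInfinite.completeQuotient_add_eq (h : IsInfinite p α) {N t : ℕ}
    (ht : ∀ n, N ≤ n → partialQuotient p α (n + t) = partialQuotient p α n) {n : ℕ} (hn : N ≤ n) :
    completeQuotient p α (n + t) = completeQuotient p α n := by
  have hp1 : (1 : ℝ) < p := by exact_mod_cast hp.out.one_lt
  have hp0 : (0 : ℝ) < p := by linarith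
  -- Inversion contracts distances by p⁻² because both complete quotients have norm at least p. The
  -- bound is proved for all n ≥ N at once, since the step from j to j + 1 uses index n + 1.
  have key : ∀ j n, N ≤ n →
      ‖completeQuotient p α (n + t) - completeQuotient p α n‖ ≤ ((p : ℝ)⁻¹ ^ 2) ^ j := by
    intro j
    induction j with
    | zero =>
      intro n hn
      have e : completeQuotient p α (n + t) - completeQuotient p α n =
          (completeQuotient p α (n + t) - (partialQuotient p α (n + t) : ℚ_[p])) +
          -(completeQuotient p α n - (partialQuotient p α n : ℚ_[p])) := by
        rw [ht n hn]; ring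
      rw [e, pow_zero]
      refine (Padic.nonarchimedean _ _).trans (max_le (norm_completeQuotient_sub_lt α _).le ?_)
      rw [norm_neg]
      exact (norm_completeQuotient_sub_lt α _).le
    | succ j ih =>
      intro n hn
      have hA := h.completeQuotient_succ_ne_zero n
      have hB := h.completeQuotient_succ_ne_zero (n + t)
      have hAn := h.le_norm_completeQuotient_succ n
      have hBn := h.le_norm_completeQuotient_succ (n + t)
      have e : completeQuotient p α (n + t) - completeQuotient p α n =
          -(completeQuotient p α (n + t + 1) - completeQuotient p α (n + 1)) *
          ((completeQuotient p α (n + t + 1))⁻¹ * (completeQuotient p α (n + 1))⁻¹) := by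
        rw [completeQuotient_eq α (n + t), completeQuotient_eq α n, ht n hn]
        field_simp
        ring
      have h1 := ih (n + 1) (by omega)
      rw [show n + 1 + t = n + t + 1 by ring] at h1
      rw [e, norm_mul, norm_neg, norm_mul, norm_inv, norm_inv, pow_succ, pow_two (p : ℝ)⁻¹]
      rw [pow_two (p : ℝ)⁻¹] at h1
      gcongr
  have hlim : Filter.Tendsto (fun j : ℕ => ((p : ℝ)⁻¹ ^ 2) ^ j) Filter.atTop (nhds 0) :=
    tendsto_pow_atTop_nhds_zero_of_lt_one (by positivity)
      (pow_lt_one₀ (by positivity) (inv_lt_one_of_one_lt₀ hp1) two_ne_zero)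
  have h0 := ge_of_tendsto' hlim fun j => key j n hn
  exact sub_eq_zero.1 (norm_le_zero_iff.1 h0)

end Algorithm

/-- Finite continued fractions with positive partial quotients act by Möbius transformations with
positive coefficients. -/
theorem exists_moebius {F : Type*} [Field F] [CharZero F] (z : ℕ → F) (q : ℕ → ℚ)
    (hq : ∀ n, 0 < q n) (hz : ∀ n, z n ≠ 0) (hrec : ∀ n, z n = q n + 1 / z (n + 1)) (k : ℕ) :
    ∃ a b c d : ℚ, 0 < a ∧ 0 < b ∧ 0 < c ∧ 0 ≤ d ∧
      z 0 * (c * z (k + 1) + d) = a * z (k + 1) + b := by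
  have hmul : ∀ n, z n * z (n + 1) = q n * z (n + 1) + 1 := fun n => by
    have := hz (n + 1)
    rw [hrec n]; field_simp
  induction k with
  | zero =>
    refine ⟨q 0, 1, 1, 0, hq 0, one_pos, one_pos, le_rfl, ?_⟩
    have := hmul 0
    push_cast
    linear_combination this
  | succ k ih =>
    obtain ⟨a, b, c, d, ha, hb, hc, hd, h⟩ := ih
    have hqk := hq (k + 1)
    -- Right multiplication of the coefficient matrix by (q, 1; 1, 0), with q the next partial
    -- quotient.
    refine ⟨a * q (k + 1) + b, a, c * q (k + 1) + d, c, by positivity, ha, by positivity, hc.le, ?_⟩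
    have h1 := hmul (k + 1)
    push_cast
    linear_combination z (k + 1 + 1) * h - (z 0 * c - a) * h1

/-! ### Conjugation in ℚ(√m) and real places. -/

section Sqrt

variable {F : Type*} [Field F] [CharZero F] {r : F} {m : ℤ}

theorem sqrt_coeff_unique (hr : r ^ 2 = (m : F)) (hm : ¬ IsSquare m) {x y : ℚ}
    (h : (x : F) + y * r = 0) : x = 0 ∧ y = 0 := by
  have h1 : ((x ^ 2 : ℚ) : F) = ((m * y ^ 2 : ℚ) : F) := by
    push_cast
    linear_combination ((x : F) - y * r) * h + (y : F) ^ 2 * hr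
  have h2 : x ^ 2 = m * y ^ 2 := by exact_mod_cast h1
  have hy : y = 0 := by
    by_contra hy
    refine hm (Rat.isSquare_intCast_iff.1 ⟨x / y, ?_⟩)
    field_simp
    linarith
  subst hy
  refine ⟨?_, rfl⟩
  simpa using h2

theorem norm_ne_zero_of_not_isSquare (hm : ¬ IsSquare m) {x y : ℚ} (h : x ≠ 0 ∨ y ≠ 0) :
    x ^ 2 - m * y ^ 2 ≠ 0 := by
  intro h0
  have hy : y ≠ 0 := by
    rintro rfl
    simp_all
  refine hm (Rat.isSquare_intCast_iff.1 ⟨x / y, ?_⟩)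
  field_simp
  linarith

/-- The graph of the isomorphism `ℚ(r) ≃ ℚ(s)` that maps the square root `r` of `m` to the square
root `s`. -/
def SqrtConj (r : F) (s : ℝ) (z : F) (w : ℝ) : Prop :=
  ∃ x y : ℚ, z = x + y * r ∧ w = x + y * s

theorem SqrtConj.right_unique (hr : r ^ 2 = (m : F)) (hm : ¬ IsSquare m) {s : ℝ} {z : F} {w w' : ℝ}
    (h : SqrtConj r s z w) (h' : SqrtConj r s z w') : w = w' := by
  obtain ⟨x, y, hz, rfl⟩ := h
  obtain ⟨x', y', hz', rfl⟩ := h'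
  obtain ⟨h1, h2⟩ := sqrt_coeff_unique hr hm (x := x - x') (y := y - y') (by
    push_cast
    linear_combination hz' - hz)
  rw [sub_eq_zero.1 h1, sub_eq_zero.1 h2]

theorem SqrtConj.add_one_div (hr : r ^ 2 = (m : F)) (hm : ¬ IsSquare m) {s : ℝ}
    (hs : s ^ 2 = (m : ℝ)) {z : F} {w : ℝ} (h : SqrtConj r s z w) (hz : z ≠ 0) (hw : w ≠ 0)
    (a : ℚ) : SqrtConj r s (a + 1 / z) (a + 1 / w) := by
  obtain ⟨x, y, hzx, hwx⟩ := h
  have hxy : x ≠ 0 ∨ y ≠ 0 := by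
    by_contra! h0
    exact hz (by simp [hzx, h0.1, h0.2])
  have hN := norm_ne_zero_of_not_isSquare hm hxy
  -- D is the common norm of z and w, so both inverses are conjugate over D and have the same
  -- rational coordinates.
  set D := x ^ 2 - m * y ^ 2 with hD
  have hDF : (D : F) = z * (x - y * r) := by
    rw [hD, hzx]
    push_cast
    linear_combination (y : F) ^ 2 * hr
  have hDR : (D : ℝ) = w * (x - y * s) := by
    rw [hD, hwx]
    push_cast
    linear_combination (y : ℝ) ^ 2 * hs
  have hNF : (D : F) ≠ 0 := by exact_mod_cast hN
  have hNR : (D : ℝ) ≠ 0 := by exact_mod_cast hN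
  refine ⟨a + x / D, -y / D, ?_, ?_⟩
  · push_cast
    field_simp
    linear_combination hDF
  · push_cast
    field_simp
    linear_combination hDR

/-- A fixed point in `ℚ(√m) \ ℚ` of a Möbius transformation with positive coefficients
has negative norm. -/
theorem norm_neg_of_moebius_fixed (hr : r ^ 2 = (m : F)) (hm : ¬ IsSquare m) {x y a b c d : ℚ}
    (hy : y ≠ 0) (hb : 0 < b) (hc : 0 < c)
    (h : ((x : F) + y * r) * (c * (x + y * r) + d) = a * (x + y * r) + b) :
    x ^ 2 - m * y ^ 2 < 0 := by
  obtain ⟨h1, h2⟩ := sqrt_coeff_unique hr hm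
    (x := c * (x ^ 2 + m * y ^ 2) + (d - a) * x - b) (y := y * (2 * c * x + d - a)) (by
      push_cast
      linear_combination h - (c : F) * y ^ 2 * hr)
  -- The √m-part of the quadratic equation determines the trace; the rational part then gives norm
  -- -b/c.
  have h3 : 2 * c * x + d - a = 0 := (mul_eq_zero.1 h2).resolve_left hy
  have h4 : c * (x ^ 2 - m * y ^ 2) = -b := by linear_combination x * h3 - h1
  by_contra! h5
  have := mul_nonneg hc.le h5
  linarith

end Sqrt

/-- A negative norm forces m > 0 and makes the two real conjugates x ± y√m differ in sign. -/
theorem exists_real_sqrt_pos {m : ℤ} {x y : ℚ} (h : x ^ 2 - m * y ^ 2 < 0) :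
    ∃ s : ℝ, s ^ 2 = m ∧ 0 < (x : ℝ) + y * s := by
  have hm : (0 : ℝ) ≤ m := by
    have : (0 : ℚ) ≤ m := by
      by_contra! hm
      nlinarith [sq_nonneg x, mul_nonneg (neg_nonneg.2 hm.le) (sq_nonneg y)]
    exact_mod_cast this
  have hR : (x : ℝ) ^ 2 < m * y ^ 2 := by
    have : x ^ 2 < m * y ^ 2 := by linarith
    exact_mod_cast this
  have hsq := Real.sq_sqrt hm
  have habs : |(x : ℝ)| < |(y : ℝ) * √(m : ℝ)| := by
    rw [← sq_lt_sq, mul_pow, hsq]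
    linarith
  rcases le_total 0 ((y : ℝ) * √(m : ℝ)) with h0 | h0
  · refine ⟨√(m : ℝ), hsq, ?_⟩
    rw [abs_of_nonneg h0] at habs
    linarith [neg_abs_le (x : ℝ)]
  · refine ⟨-√(m : ℝ), by rw [neg_sq, hsq], ?_⟩
    rw [abs_of_nonpos h0] at habs
    linarith [neg_abs_le (x : ℝ)]

/-- The tail of a periodic expansion of an element of `ℚ(√m) \ ℚ` is positive at one of the
real places. -/
theorem IsPeriodic.exists_conj_pos {p : ℕ} [hp : Fact p.Prime] {α r : ℚ_[p]} {m : ℤ}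
    (hr : r ^ 2 = (m : ℚ_[p])) (hm : ¬ IsSquare m) {x₀ y₀ : ℚ} (hy₀ : y₀ ≠ 0)
    (hα : α = x₀ + y₀ * r) (h : IsPeriodic p α) :
    ∃ (s : ℝ) (N : ℕ) (w : ℝ), 2 ≤ N ∧ s ^ 2 = m ∧ 0 < w ∧ SqrtConj r s (completeQuotient p α N) w := by
  obtain ⟨hinf, N, t, ht, hper⟩ := h
  have hcoeff : ∀ n, ∃ x y : ℚ, y ≠ 0 ∧ completeQuotient p α n = x + y * r := by
    intro n
    induction n with
    | zero => exact ⟨x₀, y₀, hy₀, hα⟩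
    | succ n ih =>
      obtain ⟨x, y, hy, hxy⟩ := ih
      set a := partialQuotient p α n with ha
      have hN := norm_ne_zero_of_not_isSquare hm (x := x - a) (Or.inr hy)
      set D := (x - a) ^ 2 - m * y ^ 2 with hD
      have hNF : (D : ℚ_[p]) ≠ 0 := by exact_mod_cast hN
      have h1 := hinf n
      rw [← ha, hxy] at h1
      refine ⟨(x - a) / D, -y / D, div_ne_zero (neg_ne_zero.2 hy) hN, ?_⟩
      rw [completeQuotient_succ, hxy, ← ha, div_eq_iff h1]
      push_cast
      field_simp
      rw [hD]
      push_cast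
      linear_combination (y : ℚ_[p]) ^ 2 * hr
  obtain ⟨k, rfl⟩ : ∃ k, t = k + 1 := ⟨t - 1, by omega⟩
  -- Starting at N + 2 avoids a_0, which may vanish, and makes the final index at least 2, as needed
  -- to reach α_2.
  obtain ⟨a, b, c, d, ha, hb, hc, hd, hmoeb⟩ := exists_moebius
    (fun n => completeQuotient p α (N + 2 + n)) (fun n => partialQuotient p α (N + 2 + n))
    (fun n => by
      rw [show N + 2 + n = N + n + 1 + 1 by ring]
      exact hinf.partialQuotient_succ_pos _)
    (fun n => by
      rw [show N + 2 + n = N + n + 1 + 1 by ring]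
      exact hinf.completeQuotient_succ_ne_zero _)
    (fun n => completeQuotient_eq α _) k
  simp only [add_zero] at hmoeb
  rw [hinf.completeQuotient_add_eq hper (Nat.le_add_right N 2)] at hmoeb
  obtain ⟨x, y, hy, hxy⟩ := hcoeff (N + 2)
  rw [hxy] at hmoeb
  obtain ⟨s, hs, hpos⟩ :=
    exists_real_sqrt_pos (norm_neg_of_moebius_fixed hr hm hy hb hc hmoeb)
  exact ⟨s, N + 2, _, Nat.le_add_left 2 N, hs, hpos, x, y, hxy, rfl⟩

/-- Positivity of a conjugate passes to all earlier complete quotients. -/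
theorem IsInfinite.conj_pos {p : ℕ} [hp : Fact p.Prime] {α r : ℚ_[p]} {m : ℤ}
    (hr : r ^ 2 = (m : ℚ_[p])) (hm : ¬ IsSquare m) (h : IsInfinite p α) {s : ℝ}
    (hs : s ^ 2 = (m : ℝ)) {N : ℕ} {w : ℝ} (hw : 0 < w)
    (hN : SqrtConj r s (completeQuotient p α N) w) {n : ℕ} (hn : n ≤ N) :
    ∃ w, 0 < w ∧ SqrtConj r s (completeQuotient p α n) w := by
  have step : ∀ n, (∃ w, 0 < w ∧ SqrtConj r s (completeQuotient p α (n + 1)) w) →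
      ∃ w, 0 < w ∧ SqrtConj r s (completeQuotient p α n) w := by
    rintro n ⟨w, hw, hn⟩
    have ha : (0 : ℝ) ≤ partialQuotient p α n := by
      exact_mod_cast (partialQuotient_mem α n).2.1
    refine ⟨partialQuotient p α n + 1 / w, by positivity, ?_⟩
    rw [completeQuotient_eq α n]
    exact hn.add_one_div hr hm hs (h.completeQuotient_succ_ne_zero n) hw.ne' _
  have below : ∀ j n, (∃ w, 0 < w ∧ SqrtConj r s (completeQuotient p α (n + j)) w) →
      ∃ w, 0 < w ∧ SqrtConj r s (completeQuotient p α n) w := by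
    intro j
    induction j with
    | zero => exact fun n hn => hn
    | succ j ih => exact fun n hn => ih n (step _ hn)
  refine below (N - n) n ⟨w, hw, ?_⟩
  rwa [Nat.add_sub_cancel' hn]

/-! ### Non-periodicity of p^k√m. -/

/-- The norm bound clears the denominator: a p^k is a positive integer. -/
theorem one_div_pow_le_of_norm_le {p : ℕ} [hp : Fact p.Prime] {a : ℚ} (ha : a ∈ digitSet p)
    (ha0 : 0 < a) {k : ℕ} (hk : ‖(a : ℚ_[p])‖ ≤ (p : ℝ) ^ k) : 1 / (p : ℚ) ^ k ≤ a := by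
  obtain ⟨⟨c, n, rfl⟩, -, -⟩ := ha
  have hpQ : (0 : ℚ) < p := by exact_mod_cast hp.out.pos
  have hpR : (0 : ℝ) < p := by exact_mod_cast hp.out.pos
  have hc : 0 < c := by
    have h1 : (0 : ℚ) < c := by
      have := mul_pos ha0 (pow_pos hpQ n)
      rwa [div_mul_cancel₀ _ (by positivity)] at this
    exact_mod_cast h1
  have h1 : ((p : ℤ) ^ n) ∣ c * (p : ℤ) ^ k := by
    rw [← Padic.norm_int_le_pow_iff_dvd]
    push_cast at hk ⊢
    rw [norm_div, norm_pow, Padic.norm_p, inv_pow, div_inv_eq_mul] at hk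
    rw [norm_mul, norm_pow, Padic.norm_p, inv_pow, zpow_neg, zpow_natCast,
      mul_inv_le_iff₀ (by positivity), inv_mul_eq_div, le_div_iff₀ (by positivity)]
    exact hk
  have h2 := Int.le_of_dvd (mul_pos hc (pow_pos (by exact_mod_cast hp.out.pos) k)) h1
  rw [div_le_div_iff₀ (by positivity) (by positivity), one_mul]
  exact_mod_cast h2

theorem not_isPeriodic_pow_mul_sqrt {p : ℕ} [hp : Fact p.Prime] {m : ℤ} {k : ℕ}
    (hpm : ¬ (p : ℤ) ∣ m) (hm : ¬ IsSquare m) (hk : 0 < k) {r : ℚ_[p]}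
    (hr : r ^ 2 = (m : ℚ_[p])) : ¬ IsPeriodic p ((p : ℚ_[p]) ^ k * r) := by
  intro h
  have hp1 : (1 : ℝ) < p := by exact_mod_cast hp.out.one_lt
  have hp0 : (0 : ℝ) < p := by linarith
  have hpQ : (0 : ℚ) < p := by exact_mod_cast hp.out.pos
  have hpp : (p : ℚ_[p]) ≠ 0 := by exact_mod_cast hp.out.ne_zero
  have hrn : ‖r‖ = 1 := by
    have h1 : ‖(m : ℚ_[p])‖ = 1 :=
      le_antisymm (Padic.norm_int_le_one m)
        (not_lt.1 fun h => hpm (Padic.norm_intCast_lt_one_iff.1 h))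
    rw [← hr, norm_pow] at h1
    exact (pow_eq_one_iff_of_nonneg (norm_nonneg r) two_ne_zero).1 h1
  have hr0 : r ≠ 0 := norm_pos_iff.1 (by rw [hrn]; exact one_pos)
  set α : ℚ_[p] := (p : ℚ_[p]) ^ k * r with hα
  have hαn : ‖α‖ = ((p : ℝ) ^ k)⁻¹ := by
    rw [hα, norm_mul, hrn, mul_one, norm_pow, Padic.norm_p, inv_pow]
  have hpk : 1 < (p : ℝ) ^ k := one_lt_pow₀ hp1 hk.ne'
  have ha0 : partialQuotient p α 0 = 0 := by
    refine (s_eq_iff p _ _).2 ⟨⟨⟨0, 0, by simp⟩, le_rfl, hpQ⟩, ?_⟩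
    rw [Rat.cast_zero, sub_zero]
    change ‖α‖ < 1
    rw [hαn]
    exact inv_lt_one_of_one_lt₀ hpk
  have hA1 : completeQuotient p α 1 = 1 / α := by
    rw [completeQuotient_succ, ha0, Rat.cast_zero, sub_zero]; rfl
  have ha1 : 1 / (p : ℚ) ^ k ≤ partialQuotient p α 1 := by
    refine one_div_pow_le_of_norm_le (partialQuotient_mem α 1) (h.1.partialQuotient_succ_pos 0) ?_
    have e : (partialQuotient p α 1 : ℚ_[p]) =
        completeQuotient p α 1 + -(completeQuotient p α 1 - (partialQuotient p α 1 : ℚ_[p])) := by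
      ring
    rw [e]
    refine (Padic.nonarchimedean _ _).trans (max_le ?_ ?_)
    · rw [hA1, norm_div, norm_one, hαn, one_div, inv_inv]
    · rw [norm_neg]
      exact (norm_completeQuotient_sub_lt α 1).le.trans hpk.le
  obtain ⟨s, N, w, hN2, hs, hw, hN⟩ := h.exists_conj_pos hr hm (x₀ := 0) (y₀ := (p : ℚ) ^ k)
    (by positivity) (by push_cast; rw [hα]; ring)
  have hm0 : (0 : ℝ) ≤ m := hs ▸ sq_nonneg s
  have hm1 : (1 : ℝ) ≤ m := by
    have h0 : m ≠ 0 := fun h0 => hm (h0 ▸ IsSquare.zero)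
    have h1 : (0 : ℤ) ≤ m := by exact_mod_cast hm0
    have h2 : (1 : ℤ) ≤ m := by omega
    exact_mod_cast h2
  obtain ⟨w₀, hw₀, hc₀⟩ := h.1.conj_pos hr hm hs hw hN (Nat.zero_le N)
  have e₀ : w₀ = (p : ℝ) ^ k * s := hc₀.right_unique hr hm
    ⟨0, (p : ℚ) ^ k, by push_cast; rw [zero_add]; rfl, by push_cast; ring⟩
  -- Positivity of the image of α_0 selects the positive real root.
  have hs0 : 0 < s := pos_of_mul_pos_right (e₀ ▸ hw₀) (by positivity)
  have hs1 : 1 ≤ s := by nlinarith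
  obtain ⟨w₂, hw₂, hc₂⟩ := h.1.conj_pos hr hm hs hw hN hN2
  -- The image of α_1 is computed twice, as a_1 + 1/w₂ and as 1/w₀.
  have hc₁ := hc₂.add_one_div hr hm hs (h.1.completeQuotient_succ_ne_zero 1) hw₂.ne'
    (partialQuotient p α 1)
  rw [← completeQuotient_eq α 1, hA1] at hc₁
  have hc₁' := hc₀.add_one_div hr hm hs (mul_ne_zero (pow_ne_zero k hpp) hr0) hw₀.ne' 0
  have e₁ := hc₁.right_unique hr hm (by rw [Rat.cast_zero, zero_add] at hc₁'; exact hc₁')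
  have ha1R : 1 / (p : ℝ) ^ k ≤ partialQuotient p α 1 := by
    have := (Rat.cast_le (K := ℝ)).2 ha1
    push_cast at this
    exact this
  have h3 : 1 / w₀ ≤ 1 / (p : ℝ) ^ k := by
    apply one_div_le_one_div_of_le (by positivity)
    rw [e₀]
    nlinarith
  have h4 : 0 < 1 / w₂ := by positivity
  simp only [Rat.cast_zero, zero_add] at e₁
  linarith

/-! ### The examples δ/p^h. -/

section Example

variable {p : ℕ} [hp : Fact p.Prime]

theorem norm_two_eq_one (hp2 : p ≠ 2) : ‖(2 : ℚ_[p])‖ = 1 := by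
  have : ‖((2 : ℕ) : ℚ_[p])‖ = 1 := by
    rw [Padic.norm_natCast_eq_one_iff]
    exact (Nat.coprime_primes hp.out Nat.prime_two).2 hp2
  exact_mod_cast this

theorem norm_add_one_eq_one (hp2 : p ≠ 2) {δ : ℚ_[p]} (h : ‖δ - 1‖ < 1) : ‖δ + 1‖ = 1 := by
  have h2 := norm_two_eq_one hp2
  have e : δ + 1 = (δ - 1) + 2 := by ring
  rw [e, Padic.add_eq_max_of_ne (by rw [h2]; exact h.ne), h2, max_eq_right h.le]

open Polynomial in
theorem existsUnique_sqrt (hp2 : p ≠ 2) {h : ℕ} (hh : 1 ≤ h) :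
    ∃! δ : ℚ_[p], δ ^ 2 = 1 + (p : ℚ_[p]) ^ (2 * h) ∧ ‖δ - 1‖ < 1 := by
  have hp1 : (1 : ℝ) < p := by exact_mod_cast hp.out.one_lt
  have hder : ‖aeval (1 : ℤ_[p]) (derivative (X ^ 2 - C (1 + (p : ℤ_[p]) ^ (2 * h)) : ℤ_[p][X]))‖ =
      1 := by
    have h2 : ‖(2 : ℤ_[p])‖ = 1 := norm_two_eq_one hp2
    rw [derivative_sub, derivative_C]
    simp [h2, one_add_one_eq_two]
  obtain ⟨z, hz, hz1, -, -⟩ := hensels_lemma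
    (F := (X ^ 2 - C (1 + (p : ℤ_[p]) ^ (2 * h)) : ℤ_[p][X])) (a := (1 : ℤ_[p])) (by
      have e : aeval (1 : ℤ_[p]) (X ^ 2 - C (1 + (p : ℤ_[p]) ^ (2 * h)) : ℤ_[p][X]) =
          -(p : ℤ_[p]) ^ (2 * h) := by
        simp only [map_sub, map_pow, aeval_X, aeval_C, Algebra.algebraMap_self, RingHom.id_apply]
        ring
      rw [hder, e, norm_neg, norm_pow, PadicInt.norm_p, one_pow]
      exact pow_lt_one₀ (by positivity) (inv_lt_one_of_one_lt₀ hp1) (by omega))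
  rw [hder] at hz1
  simp only [map_sub, map_pow, aeval_X, aeval_C, Algebra.algebraMap_self, RingHom.id_apply] at hz
  refine ⟨z, ⟨?_, ?_⟩, ?_⟩
  · have := congrArg (fun u : ℤ_[p] => (u : ℚ_[p])) hz
    push_cast at this
    linear_combination this
  · exact_mod_cast hz1
  · rintro δ ⟨hδ, hδ1⟩
    have hz' := congrArg (fun u : ℤ_[p] => (u : ℚ_[p])) hz
    push_cast at hz'
    have hz1' : ‖(z : ℚ_[p]) - 1‖ < 1 := by exact_mod_cast hz1
    have h3 : (δ - z) * (δ + z) = 0 := by linear_combination hδ - hz'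
    rcases mul_eq_zero.1 h3 with h4 | h4
    · exact sub_eq_zero.1 h4
    · exfalso
      have h5 := norm_add_one_eq_one hp2 hδ1
      -- If δ = -z, then δ + 1 = 1 - z is not a unit.
      rw [eq_neg_of_add_eq_zero_left h4, neg_add_eq_sub, norm_sub_rev] at h5
      linarith

/-- With P = p^h, the integer 1 + P² lies strictly between P² and (P + 1)². -/
theorem one_add_pow_ne_sq (h : ℕ) (b : ℚ) :
    b ^ 2 ≠ (1 + (p : ℚ) ^ (2 * h)) / (p : ℚ) ^ (2 * h) := by
  intro hb
  have hpQ : (p : ℚ) ≠ 0 := by exact_mod_cast hp.out.ne_zero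
  have hsq : IsSquare ((1 + (p : ℤ) ^ (2 * h) : ℤ) : ℚ) := by
    refine ⟨b * (p : ℚ) ^ h, ?_⟩
    rw [eq_div_iff (by positivity)] at hb
    push_cast
    rw [← hb]; ring
  obtain ⟨c, hc⟩ := Rat.isSquare_intCast_iff.1 hsq
  have hP : (0 : ℤ) < (p : ℤ) ^ h := pow_pos (by exact_mod_cast hp.out.pos) h
  have hc' : |c| ^ 2 = 1 + ((p : ℤ) ^ h) ^ 2 := by
    rw [sq_abs, ← pow_mul, mul_comm h 2]; linarith
  have h1 : (p : ℤ) ^ h < |c| := lt_of_pow_lt_pow_left₀ 2 (abs_nonneg c) (by linarith)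
  nlinarith

variable {h : ℕ} {δ : ℚ_[p]}

theorem norm_div_pow (hδ1 : ‖δ - 1‖ < 1) : ‖δ / (p : ℚ_[p]) ^ h‖ = (p : ℝ) ^ h := by
  have e : δ = (δ - 1) + 1 := by ring
  have hδ : ‖δ‖ = 1 := by
    rw [e, Padic.add_eq_max_of_ne (by rw [norm_one]; exact hδ1.ne), norm_one, max_eq_right hδ1.le]
  rw [norm_div, hδ, norm_pow, Padic.norm_p, inv_pow, one_div, inv_inv]

theorem valuation_div_pow_neg (hh : 1 ≤ h) (hδ1 : ‖δ - 1‖ < 1) :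
    (δ / (p : ℚ_[p]) ^ h).valuation < 0 := by
  have hp1 : (1 : ℝ) < p := by exact_mod_cast hp.out.one_lt
  rw [← not_le, ← Padic.norm_le_one_iff_val_nonneg, norm_div_pow hδ1, not_le]
  exact one_lt_pow₀ hp1 (by omega)

theorem isQuadraticOfTraceZero_div_pow (hδ : δ ^ 2 = 1 + (p : ℚ_[p]) ^ (2 * h)) :
    IsQuadraticOfTraceZero p (δ / (p : ℚ_[p]) ^ h) := by
  refine isQuadraticOfTraceZero_of_sq p _ _ ?_ (one_add_pow_ne_sq (p := p) h)
  push_cast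
  rw [div_pow, hδ, ← pow_mul, mul_comm h 2]

theorem natCast_div_pow_mem_digitSet {c : ℕ} (hc : c < p ^ (h + 1)) :
    (c : ℚ) / (p : ℚ) ^ h ∈ digitSet p := by
  have hpQ : (0 : ℚ) < p := by exact_mod_cast hp.out.pos
  refine ⟨⟨c, h, by push_cast; rfl⟩, by positivity, ?_⟩
  rw [div_lt_iff₀ (by positivity), ← pow_succ']
  exact_mod_cast hc

/-- As δ + 1 is a unit, (δ - 1)(δ + 1) = p^(2h) gives this quotient norm p^(-h). -/
theorem norm_sub_one_div_pow_lt (hp2 : p ≠ 2) (hh : 1 ≤ h)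
    (hδ : δ ^ 2 = 1 + (p : ℚ_[p]) ^ (2 * h)) (hδ1 : ‖δ - 1‖ < 1) :
    ‖(δ - 1) / (p : ℚ_[p]) ^ h‖ < 1 := by
  have hp1 : (1 : ℝ) < p := by exact_mod_cast hp.out.one_lt
  have hpp : (p : ℚ_[p]) ≠ 0 := by exact_mod_cast hp.out.ne_zero
  have h1 := norm_add_one_eq_one hp2 hδ1
  have h2 : (δ - 1) / (p : ℚ_[p]) ^ h * (δ + 1) = (p : ℚ_[p]) ^ h := by
    field_simp
    linear_combination hδ
  have h3 := congrArg norm h2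
  rw [norm_mul, h1, mul_one, norm_pow, Padic.norm_p] at h3
  rw [h3]
  exact pow_lt_one₀ (by positivity) (inv_lt_one_of_one_lt₀ hp1) (by omega)

theorem expansion_div_pow (hp2 : p ≠ 2) (hh : 1 ≤ h)
    (hδ : δ ^ 2 = 1 + (p : ℚ_[p]) ^ (2 * h)) (hδ1 : ‖δ - 1‖ < 1) :
    IsPeriodic p (δ / (p : ℚ_[p]) ^ h) ∧
      partialQuotient p (δ / (p : ℚ_[p]) ^ h) 0 = 1 / (p : ℚ) ^ h ∧
      ∀ n : ℕ, 1 ≤ n → partialQuotient p (δ / (p : ℚ_[p]) ^ h) n = 2 / (p : ℚ) ^ h := by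
  have hpp : (p : ℚ_[p]) ≠ 0 := by exact_mod_cast hp.out.ne_zero
  have hp2' : 2 < p := lt_of_le_of_ne hp.out.two_le hp2.symm
  have hp3 : 2 < p ^ (h + 1) := hp2'.trans_le (Nat.le_self_pow (by omega) p)
  have hsmall := norm_sub_one_div_pow_lt hp2 hh hδ hδ1
  have hprod : (δ - 1) * (δ + 1) = (p : ℚ_[p]) ^ h * (p : ℚ_[p]) ^ h := by
    linear_combination hδ
  have hne : δ - 1 ≠ 0 := by
    intro h0
    rw [h0, zero_mul] at hprod
    exact mul_ne_zero (pow_ne_zero h hpp) (pow_ne_zero h hpp) hprod.symm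
  have hinv : 1 / ((δ - 1) / (p : ℚ_[p]) ^ h) = (δ + 1) / (p : ℚ_[p]) ^ h := by
    field_simp
    linear_combination -hprod
  set α := δ / (p : ℚ_[p]) ^ h with hα
  have hq0 : partialQuotient p α 0 = 1 / (p : ℚ) ^ h := by
    refine (s_eq_iff p _ _).2
      ⟨by simpa using natCast_div_pow_mem_digitSet (c := 1) (by omega), ?_⟩
    change ‖α - _‖ < 1
    convert hsmall using 2
    rw [hα]; push_cast; ring
  have hd0 : completeQuotient p α 0 - (partialQuotient p α 0 : ℚ_[p]) =
      (δ - 1) / (p : ℚ_[p]) ^ h := by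
    rw [hq0]
    change α - _ = _
    rw [hα]; push_cast; ring
  have hs2 : s p ((δ + 1) / (p : ℚ_[p]) ^ h) = 2 / (p : ℚ) ^ h := by
    refine (s_eq_iff p _ _).2
      ⟨by simpa using natCast_div_pow_mem_digitSet (c := 2) hp3, ?_⟩
    convert hsmall using 2
    push_cast; ring
  -- The remainder never changes, which gives both infinitude and period 1.
  have hd : ∀ n, completeQuotient p α n - (partialQuotient p α n : ℚ_[p]) =
      (δ - 1) / (p : ℚ_[p]) ^ h := by
    intro n
    induction n with
    | zero => exact hd0
    | succ n ih =>
      rw [partialQuotient, completeQuotient_succ, ih, hinv, hs2]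
      push_cast; ring
  have hq : ∀ n : ℕ, 1 ≤ n → partialQuotient p α n = 2 / (p : ℚ) ^ h := by
    intro n hn
    obtain ⟨n, rfl⟩ : ∃ j, n = j + 1 := ⟨n - 1, by omega⟩
    rw [partialQuotient, completeQuotient_succ, hd, hinv, hs2]
  refine ⟨⟨fun n => ?_, 1, 1, one_pos, fun n hn => ?_⟩, hq0, hq⟩
  · rw [hd n]
    exact div_ne_zero hne (pow_ne_zero h hpp)
  · rw [hq n hn, hq (n + 1) (by omega)]

end Example

end RubanCF

theorem mainTheorem12 (p : ℕ) [Fact p.Prime] (hp : p ≠ 2) :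
    -- infinitely many quadratic `α` of trace zero and negative valuation with periodic expansion
    {α : ℚ_[p] | RubanCF.IsQuadraticOfTraceZero p α ∧ α.valuation < 0 ∧
      RubanCF.IsPeriodic p α}.Infinite ∧
    -- for example `δ / p ^ h`, whose expansion is `[1 / p ^ h, 2 / p ^ h, 2 / p ^ h, …]`
    (∀ h : ℕ, 1 ≤ h →
      (∃! δ : ℚ_[p], δ ^ 2 = 1 + (p : ℚ_[p]) ^ (2 * h) ∧ ‖δ - 1‖ < 1) ∧
      ∀ δ : ℚ_[p], δ ^ 2 = 1 + (p : ℚ_[p]) ^ (2 * h) → ‖δ - 1‖ < 1 →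
        RubanCF.IsQuadraticOfTraceZero p (δ / (p : ℚ_[p]) ^ h) ∧
        (δ / (p : ℚ_[p]) ^ h).valuation < 0 ∧
        RubanCF.IsPeriodic p (δ / (p : ℚ_[p]) ^ h) ∧
        RubanCF.partialQuotient p (δ / (p : ℚ_[p]) ^ h) 0 = 1 / (p : ℚ) ^ h ∧
        ∀ n : ℕ, 1 ≤ n →
          RubanCF.partialQuotient p (δ / (p : ℚ_[p]) ^ h) n = 2 / (p : ℚ) ^ h) ∧
    -- `p ^ k * √m` never has a periodic expansion
    (∀ (m : ℤ) (k : ℕ), ¬ (p : ℤ) ∣ m → ¬ IsSquare m → 0 < k →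
      ∀ r : ℚ_[p], r ^ 2 = (m : ℚ_[p]) → ¬ RubanCF.IsPeriodic p ((p : ℚ_[p]) ^ k * r)) := by
  have hex : ∀ h : ℕ, 1 ≤ h → ∀ δ : ℚ_[p], δ ^ 2 = 1 + (p : ℚ_[p]) ^ (2 * h) → ‖δ - 1‖ < 1 →
      RubanCF.IsQuadraticOfTraceZero p (δ / (p : ℚ_[p]) ^ h) ∧
      (δ / (p : ℚ_[p]) ^ h).valuation < 0 ∧ RubanCF.IsPeriodic p (δ / (p : ℚ_[p]) ^ h) :=
    fun h hh δ hδ hδ1 => ⟨RubanCF.isQuadraticOfTraceZero_div_pow hδ,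
      RubanCF.valuation_div_pow_neg hh hδ1, (RubanCF.expansion_div_pow hp hh hδ hδ1).1⟩
  refine ⟨?_, fun h hh => ⟨RubanCF.existsUnique_sqrt hp hh, fun δ hδ hδ1 => ?_⟩,
    fun m k hpm hm hk r hr => RubanCF.not_isPeriodic_pow_mul_sqrt hpm hm hk hr⟩
  · choose δ hδ using fun h : ℕ => (RubanCF.existsUnique_sqrt hp (Nat.le_add_left 1 h)).exists
    refine Set.infinite_of_injective_forall_mem
      (f := fun h : ℕ => δ h / (p : ℚ_[p]) ^ (h + 1)) (fun i j hij => ?_)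
      (fun h => hex (h + 1) (Nat.le_add_left 1 h) (δ h) (hδ h).1 (hδ h).2)
    -- The norms p^(h+1) tell the examples apart.
    have h1 := congrArg norm hij
    simp only [RubanCF.norm_div_pow (hδ _).2] at h1
    have h2 : p ^ (i + 1) = p ^ (j + 1) := by exact_mod_cast h1
    exact Nat.succ_injective (Nat.pow_right_injective (Fact.out : p.Prime).two_le h2)
  · obtain ⟨h1, h2, h3⟩ := hex h hh δ hδ hδ1
    exact ⟨h1, h2, h3, (RubanCF.expansion_div_pow hp hh hδ hδ1).2⟩
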